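/- Let $\mathcal A$ be a (real or complex) Banach algebra, that is, a unital associative algebra with identity $I$ whose norm is complete and satisfies $\|uv\|\le\|u\|\,\|v\|$. Write $e^{u}=\sum_{k\ge 0}u^k/k!$, $[u,v]=uv-vu$ and $(\operatorname{ad}u)(v)=[u,v]$ for $u,v\in\mathcal A$. We say that $V\in\mathcal A$ is a logarithm of $W\in\mathcal A$ if $e^{V}=W$, and that a series $\sum_n a_n$ in $\mathcal A$ is absolutely convergent if $\sum_n\|a_n\|<\infty$. For $x,y\in\mathcal A$ and $n\ge 1$ put $$L_n(x,y)=\frac{(-1)^{n+1}}{n}\,(e^xe^y-I)^n,$$ $$Z_n(x,y)=\frac1n\sum_{k=1}^n\frac{(-1)^{k+1}}{k}\sum_{\substack{(i_1,j_1),\dots,(i_k,j_k)\ne(0,0)\\ i_1+j_1+\cdots+i_k+j_k=n}}\frac{(\operatorname{ad}x)^{i_1}(\operatorname{ad}y)^{j_1}\cdots(\operatorname{ad}x)^{i_k}(\operatorname{ad}y)^{j_k-1}(y)}{i_1!\,j_1!\cdots i_k!\,j_k!},$$ where the $i_r,j_r$ are nonnegative integers and, if $j_k=0$, the numerator is understood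 to end with $(\operatorname{ad}x)^{i_k-1}(x)$. The series $\sum_{n\ge1}L_n(x,y)$ is called the Mercator series, and $\sum_{n\ge1}Z_n(x,y)=x+y+\tfrac12[x,y]+\tfrac1{12}\big([[x,y],y]+[[y,x],x]\big)+\cdots$ is called the (homogeneous) BCH series. **Proposition 2.2.** Let $x,y\in\mathcal A$. (a) If $\|x\|+\|y\|<\ln 2$, then the Mercator series $\sum_n L_n(x,y)$ and the BCH series $\sum_n Z_n(x,y)$ are both absolutely convergent, and their sums are equal. (b) If the Mercator series $\sum_n L_n(x,y)$ converges in $\mathcal A$ (not necessarily absolutely), then its sum is a logarithm of $e^xe^y$. (c) If the BCH series $\sum_n Z_n(x,y)$ converges in $\mathcal A$ (not necessarily absolutely), then its sum is a logarithm of $e^xe^y$. -/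

import Mathlib

namespace BCH

section Basic

variable {A : Type*} [NormedRing A]

/-- The series `∑_{n ≥ 1} a n` converges (possibly only conditionally) with sum `S`:
its partial sums `a 1 + ⋯ + a N` tend to `S` in the norm topology. -/
def SeriesConvergesTo (a : ℕ → A) (S : A) : Prop :=
  Filter.Tendsto (fun N : ℕ => ∑ n ∈ Finset.Icc 1 N, a n) Filter.atTop (nhds S)

/-- The series `∑_{n ≥ 1} a n` is absolutely convergent: `∑_{n ≥ 1} ‖a n‖ < ∞`. -/
def AbsolutelyConvergent (a : ℕ → A) : Prop :=
  Summable fun n : ℕ => ‖a (n + 1)‖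

/-- `V` is a logarithm of `W`: `e ^ V = W`. -/
def IsLogarithm (V W : A) : Prop :=
  NormedSpace.exp V = W

/-- The adjoint map `ad u v = [u, v] = u v - v u`. -/
def ad (u v : A) : A :=
  ⁅u, v⁆

/-- The iterated commutator
`(ad x)^{i₁} (ad y)^{j₁} ⋯ (ad x)^{iₖ} (ad y)^{jₖ - 1} (y)`
attached to a list of exponents `(i₁, j₁), …, (iₖ, jₖ)`;
if `jₖ = 0` it ends with `(ad x)^{iₖ - 1} (x)` instead.
(The empty list does not occur in Dynkin's formula.) -/
def dynkinBracket (x y : A) : List (ℕ × ℕ) → A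
  | [] => 0
  | [p] => if p.2 = 0 then (ad x)^[p.1 - 1] x else (ad x)^[p.1] ((ad y)^[p.2 - 1] y)
  | p :: q :: l => (ad x)^[p.1] ((ad y)^[p.2] (dynkinBracket x y (q :: l)))

end Basic

section Terms

variable (𝕜 : Type*) [RCLike 𝕜] {A : Type*} [NormedRing A] [NormedAlgebra 𝕜 A]

/-- The `n`-th term `L_n(x, y) = (-1)^(n+1) / n * (e^x e^y - 1)^n` (for `n ≥ 1`) of the Mercator
series for `ln (e^x e^y)`. -/
noncomputable def mercatorTerm (x y : A) (n : ℕ) : A :=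
  ((-1 : 𝕜) ^ (n + 1) / (n : 𝕜)) • (NormedSpace.exp x * NormedSpace.exp y - 1) ^ n

/-- The `k`-tuples of pairs `(i₁, j₁), …, (iₖ, jₖ)` of natural numbers, all different from
`(0, 0)`, with `i₁ + j₁ + ⋯ + iₖ + jₖ = n`. (The bound `≤ n` on the entries follows from the
last condition, and only serves to present this set as a `Finset`.) -/
def dynkinIndices (n k : ℕ) : Finset (Fin k → ℕ × ℕ) :=
  (Fintype.piFinset fun _ : Fin k => Finset.range (n + 1) ×ˢ Finset.range (n + 1)).filter
    fun p => (∀ r, p r ≠ (0, 0)) ∧ ∑ r, ((p r).1 + (p r).2) = n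

/-- The set of index tuples is the intended one: the entrywise bound is redundant. -/
theorem mem_dynkinIndices {n k : ℕ} {p : Fin k → ℕ × ℕ} :
    p ∈ dynkinIndices n k ↔ (∀ r, p r ≠ (0, 0)) ∧ ∑ r, ((p r).1 + (p r).2) = n := by
  simp only [dynkinIndices, Finset.mem_filter, Fintype.mem_piFinset, Finset.mem_product,
    Finset.mem_range, and_iff_right_iff_imp]
  rintro ⟨-, h⟩ r
  have := Finset.single_le_sum (f := fun r => (p r).1 + (p r).2) (fun _ _ => Nat.zero_le _)
    (Finset.mem_univ r)
  simp only [h] at this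
  omega

/-- The `n`-th term `Z_n(x, y)` (for `n ≥ 1`) of the homogeneous Baker-Campbell-Hausdorff series,
in Dynkin's presentation. -/
noncomputable def bchTerm (x y : A) (n : ℕ) : A :=
  (1 / (n : 𝕜)) • ∑ k ∈ Finset.Icc 1 n, ((-1 : 𝕜) ^ (k + 1) / (k : 𝕜)) •
    ∑ p ∈ dynkinIndices n k,
      (1 / ∏ r, (((p r).1.factorial : 𝕜) * ((p r).2.factorial : 𝕜))) •
        dynkinBracket x y (List.ofFn p)

end Terms

end BCH

/-! Work with formal power series over the algebra in a central variable X; put G = e^{Xx} e^{Xy}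
and P = G - 1. The algebraic core is Dynkin's formula: Z_n is the degree-n coefficient of log(1 + P)
(`bchTerm_eq_sum_coeff`). The Euler derivation E = X d/dX gives E G = W G with W = Xx + X e^{X ad x}
y. Moving derivatives to the left in E(P^k) produces the iterated commutators (ad P)^m (E P) =
T^m(W) G^{m+1}, where T = e^{X ad x} e^{X ad y} - 1. Summing over k with the logarithm's
coefficients creates the binomial series of G^{-(m+1)}, which cancels G^{m+1} and leaves E log G =
Σ_m (-1)^m/(m+1) T^m(W) (`sum_euler_log`). Expanding T and W gives Dynkin's brackets.

For (a), the double family (-1)^k/(k+1) [X^n] P^{k+1} has total norm at most Σ q^{k+1} with q =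
e^{‖x‖+‖y‖} - 1 < 1. Summed over n first it is the Mercator series, over k first the BCH series.

For (b) and (c), weight the n-th term by r^n with |r| < 1. In (b) the exponential of the weighted
sum is 1 + r(e^x e^y - 1), by differentiation in r. In (c) homogeneity of Z_n together with (a) and
(b) identifies it with e^{rx} e^{ry} for small r, and analyticity extends this to |r| < 1. Abel's
limit theorem then lets r tend to 1, and needs only conditional convergence. -/

namespace BCH

open PowerSeries

/-! ### Formal exponentials, conjugation and the Euler derivation -/

section FormalExp

variable {R : Type*} [Ring R] [Algebra ℝ R]

/-- The formal exponential `∑ xⁿ Xⁿ / n!`. -/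
noncomputable def expPS (x : R) : R⟦X⟧ :=
  PowerSeries.mk fun n => ((n.factorial : ℝ)⁻¹) • x ^ n

theorem coeff_expPS (x : R) (n : ℕ) :
    coeff n (expPS x) = ((n.factorial : ℝ)⁻¹) • x ^ n := by
  simp [expPS]

theorem expPS_zero : expPS (0 : R) = 1 := by
  ext n
  rcases n with _ | n <;> simp [coeff_expPS, coeff_one]

theorem sum_antidiagonal_exp {x y : R} (h : Commute x y) (n : ℕ) :
    ∑ p ∈ Finset.HasAntidiagonal.antidiagonal n,
      (((p.1.factorial : ℝ)⁻¹) • x ^ p.1) * (((p.2.factorial : ℝ)⁻¹) • y ^ p.2) =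
      ((n.factorial : ℝ)⁻¹) • (x + y) ^ n := by
  rw [h.add_pow', Finset.smul_sum]
  refine Finset.sum_congr rfl fun p hp => ?_
  obtain ⟨i, j⟩ := p
  simp only [Finset.HasAntidiagonal.mem_antidiagonal] at hp
  subst hp
  rw [smul_mul_smul_comm, ← Nat.cast_smul_eq_nsmul ℝ, smul_smul, Nat.cast_add_choose]
  congr 1
  have := Nat.factorial_ne_zero (i + j)
  field_simp

theorem expPS_mul_of_commute {x y : R} (h : Commute x y) :
    expPS x * expPS y = expPS (x + y) := by
  ext n
  simp only [coeff_mul, coeff_expPS]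
  exact sum_antidiagonal_exp h n

theorem expPS_mul_neg (x : R) : expPS x * expPS (-x) = 1 := by
  rw [expPS_mul_of_commute (Commute.neg_right (Commute.refl x)), add_neg_cancel, expPS_zero]

theorem expPS_neg_mul (x : R) : expPS (-x) * expPS x = 1 := by
  rw [expPS_mul_of_commute (Commute.neg_left (Commute.refl x)), neg_add_cancel, expPS_zero]

/-- The iterated commutator as a linear map. -/
def adLM (x : R) : R →ₗ[ℝ] R :=
  LinearMap.mulLeft ℝ x + LinearMap.mulRight ℝ (-x)

theorem adLM_apply (x v : R) : adLM x v = x * v - v * x := by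
  simp [adLM, sub_eq_add_neg]

/-- Left multiplication by x and right multiplication by -x commute and add up to ad x, so this is
the exponential law in the endomorphism ring, read in degree n. -/
theorem sum_antidiagonal_conj (x v : R) (n : ℕ) :
    ∑ p ∈ Finset.HasAntidiagonal.antidiagonal n,
      (((p.1.factorial : ℝ)⁻¹) • x ^ p.1) * v * (((p.2.factorial : ℝ)⁻¹) • (-x) ^ p.2) =
      ((n.factorial : ℝ)⁻¹) • (adLM x ^ n) v := by
  have h := sum_antidiagonal_exp
    (LinearMap.commute_mulLeft_right (R := ℝ) x (-x)) n
  have h' := congrArg (fun f : Module.End ℝ R => f v) h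
  simp only [LinearMap.sum_apply, Module.End.mul_apply, LinearMap.smul_apply,
    LinearMap.pow_mulLeft, LinearMap.pow_mulRight, LinearMap.mulLeft_apply,
    LinearMap.mulRight_apply] at h'
  rw [adLM, ← h']
  refine Finset.sum_congr rfl fun p _ => ?_
  simp only [smul_mul_assoc, mul_smul_comm, mul_assoc]
  rw [smul_comm]

theorem coeff_conj_expPS (x : R) (v : R⟦X⟧) (n : ℕ) :
    coeff n (expPS x * v * expPS (-x)) =
      ∑ p ∈ Finset.HasAntidiagonal.antidiagonal n, ((p.1.factorial : ℝ)⁻¹) • (adLM x ^ p.1) (coeff p.2 v) := by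
  simp only [← sum_antidiagonal_conj, coeff_mul, coeff_expPS, Finset.sum_mul]
  rw [Finset.sum_sigma', Finset.sum_sigma']
  refine Finset.sum_nbij' (fun s => ⟨(s.2.1 + s.1.2, s.2.2), (s.2.1, s.1.2)⟩)
    (fun s => ⟨(s.2.1 + s.1.2, s.2.2), (s.2.1, s.1.2)⟩) ?_ ?_ ?_ ?_ ?_
  all_goals
    rintro ⟨⟨a, b⟩, ⟨c, d⟩⟩ h
    simp only [Finset.mem_sigma, Finset.HasAntidiagonal.mem_antidiagonal] at h ⊢
  · simp; omega
  · simp; omega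
  · obtain ⟨h1, h2⟩ := h
    subst h2; rfl
  · obtain ⟨h1, h2⟩ := h
    subst h2; rfl

/-- The Euler derivation `X d/dX` on power series. -/
noncomputable def euler (f : R⟦X⟧) : R⟦X⟧ :=
  PowerSeries.mk fun n => (n : ℝ) • coeff n f

theorem coeff_euler (f : R⟦X⟧) (n : ℕ) : coeff n (euler f) = (n : ℝ) • coeff n f := by
  simp [euler]

theorem euler_mul (f g : R⟦X⟧) : euler (f * g) = euler f * g + f * euler g := by
  ext n
  simp only [coeff_euler, map_add, coeff_mul, Finset.smul_sum, ← Finset.sum_add_distrib]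
  refine Finset.sum_congr rfl fun p hp => ?_
  rw [← Finset.HasAntidiagonal.mem_antidiagonal.1 hp, smul_mul_assoc, mul_smul_comm, ← add_smul]
  push_cast; rfl

theorem euler_one : euler (1 : R⟦X⟧) = 0 := by
  ext n
  rcases n with _ | n <;> simp [coeff_euler, coeff_one]

theorem euler_sub (f g : R⟦X⟧) : euler (f - g) = euler f - euler g := by
  ext n; simp [coeff_euler, smul_sub]

theorem euler_expPS (x : R) : euler (expPS x) = C x * X * expPS x := by
  ext n
  rw [mul_assoc, coeff_C_mul, coeff_euler, coeff_expPS]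
  rcases n with _ | n
  · simp
  · rw [coeff_succ_X_mul, coeff_expPS, smul_smul, mul_smul_comm, pow_succ']
    congr 1
    rw [Nat.factorial_succ]
    push_cast
    field_simp

theorem euler_expPS_mul_expPS (x y : R) :
    euler (expPS x * expPS y) =
      (C x * X + expPS x * (C y * X) * expPS (-x)) * (expPS x * expPS y) := by
  rw [euler_mul, euler_expPS, euler_expPS, add_mul]
  congr 1
  · simp only [mul_assoc]
  · rw [mul_assoc _ (expPS (-x)), ← mul_assoc (expPS (-x)), expPS_neg_mul, one_mul]
    simp only [mul_assoc]

end FormalExp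

/-! ### Derivation of a power and the truncated negative binomial series -/

section PowerRule

variable {B : Type*} [Ring B]

/-- Induction on k: P d_m = d_{m+1} + d_m P moves each new factor P to the right, and Pascal's rule
collects the coefficients. -/
theorem leibniz_pow_eq_sum (D : B → B) (hD : ∀ f g, D (f * g) = D f * g + f * D g)
    (h1 : D 1 = 0) (P : B) (d : ℕ → B) (hd0 : d 0 = D P)
    (hd : ∀ m, d (m + 1) = P * d m - d m * P) (k : ℕ) :
    D (P ^ k) = ∑ m ∈ Finset.range k, (k.choose (m + 1)) • (d m * P ^ (k - 1 - m)) := by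
  have key : ∀ k, D (P ^ (k + 1)) = ∑ p ∈ Finset.HasAntidiagonal.antidiagonal k,
      ((k + 1).choose (p.1 + 1)) • (d p.1 * P ^ p.2) := by
    intro k
    induction k with
    | zero => simp [hd0]
    | succ k ih =>
      have hP : ∀ m, P * d m = d (m + 1) + d m * P := fun m => by rw [hd]; abel
      rw [pow_succ', hD, ih, ← hd0, Finset.mul_sum]
      have e : ∀ p : ℕ × ℕ, P * ((k + 1).choose (p.1 + 1) • (d p.1 * P ^ p.2)) =
          (k + 1).choose (p.1 + 1) • (d (p.1 + 1) * P ^ p.2) +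
          (k + 1).choose (p.1 + 1) • (d p.1 * P ^ (p.2 + 1)) := by
        intro p
        rw [mul_smul_comm, ← mul_assoc, hP, add_mul, smul_add, mul_assoc, ← pow_succ']
      simp only [e, Finset.sum_add_distrib]
      have e2 : ∀ p : ℕ × ℕ, (k + 1 + 1).choose (p.1 + 1) • (d p.1 * P ^ p.2) =
          (k + 1).choose p.1 • (d p.1 * P ^ p.2) +
          (k + 1).choose (p.1 + 1) • (d p.1 * P ^ p.2) := by
        intro p
        rw [Nat.choose_succ_succ, add_smul]
      simp only [e2, Finset.sum_add_distrib]
      rw [Finset.Nat.sum_antidiagonal_succ (n := k), Finset.Nat.sum_antidiagonal_succ' (n := k)]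
      simp [add_assoc]
  rcases k with _ | k
  · simpa using h1
  · rw [key, Finset.Nat.sum_antidiagonal_eq_sum_range_succ_mk]
    refine Finset.sum_congr rfl fun m _ => ?_
    simp

/-- The sum truncates the series of (1 + P)^{-(m+1)}. By Pascal's rule one factor 1 + P lowers m by
one, up to a single multiple of P^J. Truncation avoids any notion of infinite sum in the ring. -/
theorem one_add_pow_mul_sum_choose (P : B) (J m : ℕ) :
    ∃ Q : B, (1 + P) ^ (m + 1) *
      ∑ j ∈ Finset.range J, ((-1 : ℤ) ^ j * (m + j).choose m) • P ^ j = 1 + P ^ J * Q := by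
  induction m with
  | zero =>
    refine ⟨-(-1) ^ J, ?_⟩
    induction J with
    | zero => simp
    | succ J ih =>
      rw [Finset.sum_range_succ, mul_add, ih]
      simp only [zero_add, pow_one, Nat.choose_zero_right, Nat.cast_one, mul_one, zsmul_eq_mul]
      push_cast
      rcases neg_one_pow_eq_or B J with h | h <;>
        (simp only [pow_succ _ J, h]; simp [add_mul, pow_mul_comm']; try abel)
  | succ m ih =>
    obtain ⟨Q, hQ⟩ := ih
    have h : ∃ c : ℤ, (1 + P) * ∑ j ∈ Finset.range J,
        ((-1 : ℤ) ^ j * (m + 1 + j).choose (m + 1)) • P ^ j =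
        ∑ j ∈ Finset.range J, ((-1 : ℤ) ^ j * (m + j).choose m) • P ^ j + c • P ^ J := by
      refine ⟨-((-1) ^ J * (m + J).choose (m + 1)), ?_⟩
      clear hQ
      induction J with
      | zero => simp
      | succ J ihJ =>
        rw [Finset.sum_range_succ, mul_add, ihJ, Finset.sum_range_succ]
        have e : ((-1 : ℤ) ^ J * (m + 1 + J).choose (m + 1)) =
            (-1) ^ J * (m + J).choose m + (-1) ^ J * (m + J).choose (m + 1) := by
          rw [show m + 1 + J = m + J + 1 by ring, Nat.choose_succ_succ]
          push_cast
          ring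
        rw [show m + (J + 1) = m + 1 + J by ring, pow_succ (-1 : ℤ), mul_smul_comm, add_mul,
          one_mul, ← pow_succ', smul_add, mul_neg_one, neg_mul, neg_neg]
        nth_rewrite 1 [e]
        rw [add_smul, neg_smul]
        abel
    obtain ⟨c, hc⟩ := h
    refine ⟨Q + c • (1 + P) ^ (m + 1), ?_⟩
    have hcomm : (1 + P) ^ (m + 1) * P ^ J = P ^ J * (1 + P) ^ (m + 1) :=
      (((Commute.one_left P).add_left (Commute.refl P)).pow_pow _ _).eq
    rw [pow_succ, mul_assoc, hc, mul_add, hQ, mul_smul_comm, hcomm, mul_add, mul_smul_comm,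
      add_assoc]

end PowerRule

end BCH

namespace BCH

open PowerSeries

/-! ### The Euler derivative of log(e^{Xx} e^{Xy}) -/

section Identity

variable {R : Type*} [Ring R] [Algebra ℝ R]

/-- The power series `e^{X x} e^{X y} - 1`. -/
noncomputable def prodSubOne (x y : R) : R⟦X⟧ :=
  expPS x * expPS y - 1

/-- The operator `e^{X ad x} e^{X ad y} - 1` on power series. -/
noncomputable def conjSubSelf (x y : R) (v : R⟦X⟧) : R⟦X⟧ :=
  expPS x * (expPS y * v * expPS (-y)) * expPS (-x) - v

/-- The series `X x + X e^{X ad x} y`, the right logarithmic Euler derivative of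
`e^{X x} e^{X y}`. -/
noncomputable def logEuler (x y : R) : R⟦X⟧ :=
  C x * X + expPS x * (C y * X) * expPS (-x)

theorem expPS_mul_mul_inv (x y : R) :
    expPS x * expPS y * (expPS (-y) * expPS (-x)) = 1 := by
  rw [mul_assoc, ← mul_assoc (expPS y), expPS_mul_neg, one_mul, expPS_mul_neg]

theorem inv_mul_expPS_mul (x y : R) :
    expPS (-y) * expPS (-x) * (expPS x * expPS y) = 1 := by
  rw [mul_assoc, ← mul_assoc (expPS (-x)), expPS_neg_mul, one_mul, expPS_neg_mul]

theorem euler_prodSubOne (x y : R) :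
    euler (prodSubOne x y) = logEuler x y * (expPS x * expPS y) := by
  rw [prodSubOne, euler_sub, euler_one, sub_zero, euler_expPS_mul_expPS, logEuler]

theorem constantCoeff_prodSubOne (x y : R) : constantCoeff (prodSubOne x y) = 0 := by
  simp [prodSubOne, expPS]

theorem conjSubSelf_eq (x y : R) (v : R⟦X⟧) :
    conjSubSelf x y v =
      (prodSubOne x y * v - v * prodSubOne x y) * (expPS (-y) * expPS (-x)) := by
  have h := expPS_mul_mul_inv x y
  have e : prodSubOne x y * v - v * prodSubOne x y =
      expPS x * expPS y * v - v * (expPS x * expPS y) := by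
    simp only [prodSubOne]; noncomm_ring
  rw [e, sub_mul, mul_assoc v, h, mul_one, conjSubSelf]
  simp only [mul_assoc]

/-- The power rule applies with d_m = T^m(W) G^{m+1}, G = 1 + P: since P commutes with G and T v =
[P, v] G^{-1}, one has [P, v G^{m+1}] = T(v) G^{m+2}. -/
theorem euler_prodSubOne_pow (x y : R) (k : ℕ) :
    euler (prodSubOne x y ^ k) = ∑ m ∈ Finset.range k, (k.choose (m + 1)) •
      ((conjSubSelf x y)^[m] (logEuler x y) * (1 + prodSubOne x y) ^ (m + 1) *
        prodSubOne x y ^ (k - 1 - m)) := by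
  have hG : 1 + prodSubOne x y = expPS x * expPS y := by simp [prodSubOne]
  refine leibniz_pow_eq_sum euler euler_mul euler_one (prodSubOne x y)
    (fun m => (conjSubSelf x y)^[m] (logEuler x y) * (1 + prodSubOne x y) ^ (m + 1)) ?_ ?_ k
  · rw [euler_prodSubOne, hG]; simp
  · intro m
    have h1 := inv_mul_expPS_mul x y
    have hc : (1 + prodSubOne x y) ^ (m + 1) * prodSubOne x y =
        prodSubOne x y * (1 + prodSubOne x y) ^ (m + 1) :=
      (((Commute.one_left _).add_left (Commute.refl (prodSubOne x y))).pow_left _).eq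
    simp only [Function.iterate_succ_apply', conjSubSelf_eq]
    rw [pow_succ' _ (m + 1), mul_assoc _ _ ((1 + prodSubOne x y) * _), ← mul_assoc _ (1 + _) _,
      hG, h1, one_mul, ← hG, sub_mul, mul_assoc (_ : R⟦X⟧) (prodSubOne x y) (_ ^ _), ← hc]
    simp only [mul_assoc]

theorem one_le_order_prodSubOne (x y : R) : 1 ≤ (prodSubOne x y).order :=
  one_le_order_iff_constCoeff_eq_zero.2 (constantCoeff_prodSubOne x y)

theorem le_order_conjSubSelf (x y : R) (v : R⟦X⟧) : v.order + 1 ≤ (conjSubSelf x y v).order := by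
  have h1 := one_le_order_prodSubOne x y
  rw [conjSubSelf_eq]
  refine le_trans ?_ (le_order_mul _ _)
  refine le_trans ?_ le_self_add
  rw [sub_eq_add_neg]
  refine le_trans (le_min ?_ ?_) (min_order_le_order_add _ _)
  · refine le_trans ?_ (le_order_mul _ _)
    rw [add_comm]; gcongr
  · rw [order_neg]
    refine le_trans ?_ (le_order_mul _ _)
    gcongr

theorem le_order_iterate_conjSubSelf (x y : R) (m : ℕ) :
    ((m + 1 : ℕ) : ℕ∞) ≤ ((conjSubSelf x y)^[m] (logEuler x y)).order := by
  induction m with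
  | zero =>
    rw [zero_add, Nat.cast_one]
    refine one_le_order_iff_constCoeff_eq_zero.2 ?_
    simp [logEuler]
  | succ m ih =>
    rw [Function.iterate_succ_apply']
    refine le_trans ?_ (le_order_conjSubSelf _ _ _)
    push_cast at ih ⊢
    gcongr

/-- The truncation error carries P^{n-m}, and T^m(W) has order at least m + 1, so the error starts
beyond degree n. -/
theorem coeff_iterate_mul_sum_choose (x y : R) {n m : ℕ} (hm : m < n) :
    coeff n ((conjSubSelf x y)^[m] (logEuler x y) * (1 + prodSubOne x y) ^ (m + 1) *
      ∑ j ∈ Finset.range (n - m), ((-1 : ℤ) ^ j * (m + j).choose m) • prodSubOne x y ^ j) =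
    coeff n ((conjSubSelf x y)^[m] (logEuler x y)) := by
  obtain ⟨Q, hQ⟩ := one_add_pow_mul_sum_choose (prodSubOne x y) (n - m) m
  rw [mul_assoc, hQ, mul_add, mul_one, map_add, add_eq_left]
  apply coeff_of_lt_order
  have h1 := le_order_iterate_conjSubSelf x y m
  have h2 := le_order_pow_of_constantCoeff_eq_zero (n - m) (constantCoeff_prodSubOne x y)
  calc (n : ℕ∞) < ((m + 1 + (n - m) : ℕ) : ℕ∞) := by
        rw [Nat.cast_lt]; omega
    _ = ((m + 1 : ℕ) : ℕ∞) + ((n - m : ℕ) : ℕ∞) := by rw [Nat.cast_add]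
    _ ≤ _ + _ := add_le_add h1 (h2.trans (le_self_add.trans (le_order_mul _ Q)))
    _ ≤ _ := le_order_mul _ _

theorem sum_euler_log (x y : R) (n : ℕ) :
    ∑ k ∈ Finset.range n, ((-1 : ℝ) ^ k / (k + 1)) • coeff n (euler (prodSubOne x y ^ (k + 1))) =
      ∑ m ∈ Finset.range n, ((-1 : ℝ) ^ m / (m + 1)) •
        coeff n ((conjSubSelf x y)^[m] (logEuler x y)) := by
  set P := prodSubOne x y with hP
  set w : ℕ → R⟦X⟧ := fun m => (conjSubSelf x y)^[m] (logEuler x y) with hw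
  have e1 : ∀ k ∈ Finset.range n,
      ((-1 : ℝ) ^ k / (k + 1)) • coeff n (euler (P ^ (k + 1))) =
      ∑ m ∈ Finset.range n, ((-1 : ℝ) ^ k / (m + 1) * k.choose m) •
        coeff n (w m * (1 + P) ^ (m + 1) * P ^ (k - m)) := by
    intro k hk
    rw [euler_prodSubOne_pow, map_sum, Finset.smul_sum]
    have hsub : Finset.range (k + 1) ⊆ Finset.range n := by
      intro a; simp only [Finset.mem_range] at *; omega
    rw [← Finset.sum_subset hsub]
    · refine Finset.sum_congr rfl fun m _ => ?_
      rw [← Nat.cast_smul_eq_nsmul ℝ, coeff_smul, smul_smul, Nat.add_sub_cancel]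
      -- Absorption: C(k+1, m+1)/(k+1) = C(k, m)/(m+1).
      congr 1
      have := Nat.add_one_mul_choose_eq k m
      have h' : ((k : ℝ) + 1) * k.choose m = (k + 1).choose (m + 1) * (m + 1) := by
        exact_mod_cast this
      field_simp
      linarith
    · intro m _ hm
      rw [Nat.choose_eq_zero_of_lt (by simpa [Nat.lt_succ_iff] using hm)]
      simp
  rw [Finset.sum_congr rfl e1, Finset.sum_comm]
  refine Finset.sum_congr rfl fun m hm => ?_
  rw [Finset.mem_range] at hm
  -- Terms with k < m vanish; the substitution k = m + j turns the rest into the truncated binomial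
  -- series.
  rw [← coeff_iterate_mul_sum_choose x y hm, Finset.mul_sum, map_sum, Finset.smul_sum,
    Finset.range_eq_Ico, ← Finset.sum_Ico_consecutive _ (Nat.zero_le m) hm.le,
    Finset.sum_eq_zero, zero_add, Finset.sum_Ico_eq_sum_range]
  · refine Finset.sum_congr rfl fun j _ => ?_
    rw [Nat.add_sub_cancel_left, mul_smul_comm, ← Int.cast_smul_eq_zsmul ℝ, coeff_smul, smul_smul]
    congr 1
    push_cast
    ring
  · intro k hk
    rw [Nat.choose_eq_zero_of_lt (Finset.mem_Ico.1 hk).2]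
    simp

end Identity

end BCH

namespace BCH

open PowerSeries

/-! ### Dynkin's sums as coefficients -/

section Dynkin

theorem sum_Icc_one {M : Type*} [AddCommMonoid M] (f : ℕ → M) (n : ℕ) :
    ∑ k ∈ Finset.Icc 1 n, f k = ∑ k ∈ Finset.range n, f (k + 1) := by
  rw [Finset.range_eq_Ico, Finset.sum_Ico_add' f 0 n 1]
  rfl

/-- Splits off the first pair (i₁, j₁); the nested antidiagonals match the coefficients of a double
conjugation. -/
theorem sum_dynkinIndices_succ {M : Type*} [AddCommMonoid M] (n k : ℕ)
    (F : (Fin (k + 1) → ℕ × ℕ) → M) :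
    ∑ p ∈ dynkinIndices n (k + 1), F p =
      ∑ q ∈ Finset.HasAntidiagonal.antidiagonal n,
        ∑ r ∈ Finset.HasAntidiagonal.antidiagonal q.2,
          if (q.1, r.1) ≠ (0, 0) then
            ∑ p ∈ dynkinIndices r.2 k, F (Fin.cons (q.1, r.1) p) else 0 := by
  rw [Finset.sum_sigma', ← Finset.sum_filter, Finset.sum_sigma']
  refine Finset.sum_bij'
    (fun p _ => ⟨⟨((p 0).1, n - (p 0).1), ((p 0).2, n - (p 0).1 - (p 0).2)⟩, Fin.tail p⟩)
    (fun s _ => Fin.cons (s.1.1.1, s.1.2.1) s.2) ?_ ?_ ?_ ?_ ?_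
  · intro p hp
    rw [mem_dynkinIndices, Fin.sum_univ_succ] at hp
    obtain ⟨h1, h2⟩ := hp
    simp only [Finset.mem_sigma, Finset.mem_filter, Finset.HasAntidiagonal.mem_antidiagonal,
      mem_dynkinIndices]
    refine ⟨⟨⟨by omega, by omega⟩, h1 0⟩, fun r => h1 r.succ, ?_⟩
    simp only [Fin.tail]
    omega
  · rintro ⟨⟨⟨a, b⟩, ⟨c, d⟩⟩, p⟩ h
    simp only [Finset.mem_sigma, Finset.mem_filter, Finset.HasAntidiagonal.mem_antidiagonal,
      mem_dynkinIndices] at h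
    obtain ⟨⟨⟨h1, h2⟩, h3⟩, h4, h5⟩ := h
    rw [mem_dynkinIndices, Fin.sum_univ_succ]
    refine ⟨fun r => ?_, ?_⟩
    · refine Fin.cases ?_ (fun r => ?_) r
      · simpa using h3
      · simpa using h4 r
    · simp only [Fin.cons_zero, Fin.cons_succ]
      omega
  · intro p _
    exact Fin.cons_self_tail p
  · rintro ⟨⟨⟨a, b⟩, ⟨c, d⟩⟩, p⟩ h
    simp only [Finset.mem_sigma, Finset.mem_filter, Finset.HasAntidiagonal.mem_antidiagonal,
      mem_dynkinIndices] at h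
    obtain ⟨⟨⟨h1, h2⟩, h3⟩, h4, h5⟩ := h
    subst h2
    subst h1
    simp
  · intro p _
    rw [show (((p 0).1, (p 0).2) : ℕ × ℕ) = p 0 from rfl, Fin.cons_self_tail]

variable {A : Type*} [NormedRing A] [NormedAlgebra ℝ A]

theorem iterate_ad (x v : A) (i : ℕ) : (ad x)^[i] v = (adLM x ^ i) v := by
  rw [Module.End.pow_apply]
  congr 1
  ext w
  rw [adLM_apply, ad, Ring.lie_def]

/-- The inner sum over `k`-tuples of exponents in Dynkin's formula. -/
noncomputable def dynkinSum (x y : A) (n k : ℕ) : A :=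
  ∑ p ∈ dynkinIndices n k, (1 / ∏ r, (((p r).1.factorial : ℝ) * ((p r).2.factorial : ℝ))) •
    dynkinBracket x y (List.ofFn p)

theorem adLM_pow_self {i : ℕ} (hi : i ≠ 0) (x : A) : (adLM x ^ i) x = 0 := by
  obtain ⟨i, rfl⟩ := Nat.exists_eq_succ_of_ne_zero hi
  rw [pow_succ, Module.End.mul_apply, adLM_apply, sub_self, map_zero]

theorem dynkinIndices_zero (n : ℕ) :
    dynkinIndices n 0 = if n = 0 then Finset.univ else ∅ := by
  ext p
  rw [mem_dynkinIndices]
  split_ifs with h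
  · simp [h, eq_iff_true_of_subsingleton]
  · simp [Ne.symm h]

theorem coeff_logEuler (x y : A) (n : ℕ) : coeff n (logEuler x y) =
    ∑ q ∈ Finset.HasAntidiagonal.antidiagonal n,
      ((if q = (1, 0) then x else 0) +
        ((q.1.factorial : ℝ)⁻¹) • (adLM x ^ q.1) (if q.2 = 1 then y else 0)) := by
  have hX : ∀ (z : A) c, coeff c (C z * X : A⟦X⟧) = if c = 1 then z else 0 := fun z c => by
    rw [coeff_C_mul, coeff_X]; split_ifs <;> simp
  rw [logEuler, map_add, coeff_conj_expPS, Finset.sum_add_distrib]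
  simp only [hX]
  congr 1
  rw [Finset.sum_ite_eq']
  simp [eq_comm]

/-- Subtracting v removes exactly the term (0, 0), which is the source of the condition on the index
pairs in Dynkin's formula. -/
theorem coeff_conjSubSelf (x y : A) (v : A⟦X⟧) (n : ℕ) : coeff n (conjSubSelf x y v) =
    ∑ q ∈ Finset.HasAntidiagonal.antidiagonal n,
      ∑ r ∈ Finset.HasAntidiagonal.antidiagonal q.2,
        if (q.1, r.1) ≠ (0, 0) then
          ((q.1.factorial : ℝ)⁻¹) • (adLM x ^ q.1) (((r.1.factorial : ℝ)⁻¹) •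
            (adLM y ^ r.1) (coeff r.2 v)) else 0 := by
  rw [conjSubSelf, map_sub, coeff_conj_expPS]
  simp only [coeff_conj_expPS, map_sum, Finset.smul_sum]
  have h : coeff n v = ∑ q ∈ Finset.HasAntidiagonal.antidiagonal n,
      ∑ r ∈ Finset.HasAntidiagonal.antidiagonal q.2,
        if (q.1, r.1) = (0, 0) then coeff r.2 v else 0 := by
    rw [Finset.sum_eq_single (0, n), Finset.sum_eq_single (0, n)]
    · simp
    · rintro ⟨a, b⟩ h1 h2
      simp only [Finset.HasAntidiagonal.mem_antidiagonal] at h1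
      rw [if_neg]
      intro h3
      simp only [Prod.mk.injEq, true_and] at h3
      simp [h3] at h1 h2
      exact h2 h1
    · simp
    · rintro ⟨a, b⟩ h1 h2
      simp only [Finset.HasAntidiagonal.mem_antidiagonal] at h1
      refine Finset.sum_eq_zero fun r _ => if_neg fun h3 => ?_
      simp only [Prod.mk.injEq] at h3
      simp [h3.1] at h1 h2
      exact h2 h1
    · simp
  rw [h, ← Finset.sum_sub_distrib]
  refine Finset.sum_congr rfl fun q _ => ?_
  rw [← Finset.sum_sub_distrib]
  refine Finset.sum_congr rfl fun r _ => ?_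
  by_cases h : (q.1, r.1) = (0, 0)
  · rw [if_pos h, if_neg (not_not.2 h)]
    simp only [Prod.mk.injEq] at h
    simp [h.1, h.2]
  · rw [if_neg h, if_pos h, sub_zero]

/-- For one pair (i, j), the bracket vanishes if j ≥ 2, or if j = 0 and i ≥ 2. What survives is x
and the terms (ad x)^i(y)/i!, which make up W. -/
theorem dynkinSum_one (x y : A) (n : ℕ) : dynkinSum x y n 1 = coeff n (logEuler x y) := by
  rw [dynkinSum, sum_dynkinIndices_succ, coeff_logEuler]
  refine Finset.sum_congr rfl fun q _ => ?_
  obtain ⟨i, m⟩ := q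
  rw [Finset.sum_eq_single (m, 0)]
  · simp only [dynkinIndices_zero, if_true, Finset.univ_unique, Finset.sum_singleton,
      Finset.prod_singleton, List.ofFn_succ, List.ofFn_zero, Fin.cons_zero, dynkinBracket,
      iterate_ad, Fin.default_eq_zero]
    rcases m with _ | _ | m
    · rcases i with _ | _ | i
      · simp
      · simp
      · simp [adLM_pow_self]
    · simp
    · simp [adLM_pow_self]
  · rintro ⟨a, b⟩ h1 h2
    simp only [Finset.HasAntidiagonal.mem_antidiagonal] at h1
    have hb : b ≠ 0 := by
      rintro rfl
      simp at h1 h2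
      exact h2 h1
    simp [dynkinIndices_zero, hb]
  · simp

theorem dynkinSum_succ_succ (x y : A) (n k : ℕ) : dynkinSum x y n (k + 2) =
    ∑ q ∈ Finset.HasAntidiagonal.antidiagonal n,
      ∑ r ∈ Finset.HasAntidiagonal.antidiagonal q.2,
        if (q.1, r.1) ≠ (0, 0) then
          ((q.1.factorial : ℝ)⁻¹) • (adLM x ^ q.1) (((r.1.factorial : ℝ)⁻¹) •
            (adLM y ^ r.1) (dynkinSum x y r.2 (k + 1))) else 0 := by
  rw [dynkinSum, sum_dynkinIndices_succ]
  refine Finset.sum_congr rfl fun q _ => Finset.sum_congr rfl fun r _ => ?_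
  congr 1
  simp only [dynkinSum, map_sum, Finset.smul_sum]
  refine Finset.sum_congr rfl fun p _ => ?_
  rw [List.ofFn_succ, List.ofFn_succ, Fin.prod_univ_succ]
  simp only [Fin.cons_zero, Fin.cons_succ, dynkinBracket, iterate_ad, map_smul, smul_smul]
  rw [← List.ofFn_succ]
  congr 1
  rw [one_div, one_div, mul_inv, mul_inv, mul_assoc]

theorem dynkinSum_succ (x y : A) (n k : ℕ) :
    dynkinSum x y n (k + 1) = coeff n ((conjSubSelf x y)^[k] (logEuler x y)) := by
  induction k generalizing n with
  | zero => exact dynkinSum_one x y n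
  | succ k ih =>
    rw [Function.iterate_succ_apply', coeff_conjSubSelf, dynkinSum_succ_succ]
    simp only [ih]

/-- Dynkin's formula: the `n`-th term of the BCH series is the homogeneous part of degree `n` of
`log (e^x e^y)`. -/
theorem bchTerm_eq_sum_coeff (x y : A) (n : ℕ) : bchTerm ℝ x y n =
    ∑ k ∈ Finset.range n, ((-1 : ℝ) ^ k / (k + 1)) • coeff n (prodSubOne x y ^ (k + 1)) := by
  rcases Nat.eq_zero_or_pos n with rfl | hn
  · simp [bchTerm]
  have h := sum_euler_log x y n
  simp only [coeff_euler, ← dynkinSum_succ] at h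
  have hn' : (n : ℝ) ≠ 0 := by positivity
  have e : bchTerm ℝ x y n =
      (1 / (n : ℝ)) • ∑ k ∈ Finset.range n, ((-1 : ℝ) ^ k / (k + 1)) • dynkinSum x y n (k + 1) := by
    rw [bchTerm, sum_Icc_one]
    congr 1
    refine Finset.sum_congr rfl fun k _ => ?_
    rw [dynkinSum, pow_succ, pow_succ]
    push_cast
    simp
  -- The factor n produced by the Euler derivation cancels the 1/n in Z_n.
  rw [e, ← h, Finset.smul_sum]
  refine Finset.sum_congr rfl fun k _ => ?_
  rw [smul_comm _ (n : ℝ), smul_smul, one_div, inv_mul_cancel₀ hn', one_smul]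

end Dynkin

end BCH

namespace BCH

open PowerSeries

/-! ### Absolute convergence and equality of the sums -/

section Absolute

variable {A : Type*} [NormedRing A]

theorem AbsolutelyConvergent.seriesConvergesTo [CompleteSpace A] {a : ℕ → A}
    (h : AbsolutelyConvergent a) : SeriesConvergesTo a (∑' n, a (n + 1)) := by
  have := (Summable.of_norm h).hasSum.tendsto_sum_nat
  simpa only [SeriesConvergesTo, sum_Icc_one] using this

theorem summable_norm_coeff_mul {f g : A⟦X⟧} (hf : Summable fun n => ‖coeff n f‖)
    (hg : Summable fun n => ‖coeff n g‖) : Summable fun n => ‖coeff n (f * g)‖ := by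
  simp only [coeff_mul]
  exact summable_norm_sum_mul_antidiagonal_of_summable_norm (f := fun n => coeff n f)
    (g := fun n => coeff n g) hf hg

theorem tsum_coeff_mul [CompleteSpace A] {f g : A⟦X⟧} (hf : Summable fun n => ‖coeff n f‖)
    (hg : Summable fun n => ‖coeff n g‖) :
    ∑' n, coeff n (f * g) = (∑' n, coeff n f) * ∑' n, coeff n g := by
  simp only [coeff_mul]
  exact (tsum_mul_tsum_eq_tsum_sum_antidiagonal_of_summable_norm (f := fun n => coeff n f)
    (g := fun n => coeff n g) hf hg).symm

theorem tsum_norm_coeff_mul_le {f g : A⟦X⟧} (hf : Summable fun n => ‖coeff n f‖)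
    (hg : Summable fun n => ‖coeff n g‖) :
    ∑' n, ‖coeff n (f * g)‖ ≤ (∑' n, ‖coeff n f‖) * ∑' n, ‖coeff n g‖ := by
  have hf' : Summable fun n => ‖(‖coeff n f‖ : ℝ)‖ := by simpa using hf
  have hg' : Summable fun n => ‖(‖coeff n g‖ : ℝ)‖ := by simpa using hg
  rw [tsum_mul_tsum_eq_tsum_sum_antidiagonal_of_summable_norm hf' hg']
  refine (summable_norm_coeff_mul hf hg).tsum_le_tsum (fun n => ?_)
    (summable_norm_sum_mul_antidiagonal_of_summable_norm hf' hg').of_norm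
  rw [coeff_mul]
  exact (norm_sum_le _ _).trans (Finset.sum_le_sum fun p _ => norm_mul_le _ _)

variable [NormedAlgebra ℝ A]

theorem summable_norm_coeff_expPS (x : A) : Summable fun n => ‖coeff n (expPS x)‖ := by
  simp only [coeff_expPS]
  exact NormedSpace.norm_expSeries_summable' (𝕂 := ℝ) x

/-- Degree 0 is excluded because ‖1‖ = 1 is not assumed; for the same reason the proof treats zero
exponents separately. -/
theorem norm_coeff_expPS_mul_le (x y : A) {n : ℕ} (hn : n ≠ 0) :
    ‖coeff n (expPS x * expPS y)‖ ≤ ((n.factorial : ℝ)⁻¹) • (‖x‖ + ‖y‖) ^ n := by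
  rw [← sum_antidiagonal_exp (Commute.all ‖x‖ ‖y‖), coeff_mul]
  refine (norm_sum_le _ _).trans (Finset.sum_le_sum fun p hp => ?_)
  obtain ⟨i, j⟩ := p
  rw [Finset.HasAntidiagonal.mem_antidiagonal] at hp
  simp only [coeff_expPS, smul_mul_smul_comm, norm_smul, smul_eq_mul, norm_mul, norm_inv,
    Real.norm_natCast]
  have hij : ‖x ^ i * y ^ j‖ ≤ ‖x‖ ^ i * ‖y‖ ^ j := by
    rcases Nat.eq_zero_or_pos i with rfl | hi
    · simpa using norm_pow_le' y (n := j) (by omega)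
    rcases Nat.eq_zero_or_pos j with rfl | hj
    · simpa using norm_pow_le' x hi
    exact (norm_mul_le _ _).trans
      (mul_le_mul (norm_pow_le' x hi) (norm_pow_le' y hj) (norm_nonneg _) (by positivity))
  rw [mul_mul_mul_comm]
  exact mul_le_mul_of_nonneg_left hij (by positivity)

theorem summable_norm_coeff_prodSubOne (x y : A) :
    Summable fun n => ‖coeff n (prodSubOne x y)‖ := by
  have h1 : Summable fun n => ‖coeff n (1 : A⟦X⟧)‖ := by
    refine summable_of_ne_finset_zero (s := {0}) fun n hn => ?_
    rw [coeff_one, if_neg (by simpa using hn), norm_zero]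
  refine Summable.of_nonneg_of_le (fun n => norm_nonneg _) (fun n => ?_)
    ((summable_norm_coeff_mul (summable_norm_coeff_expPS x) (summable_norm_coeff_expPS y)).add h1)
  rw [prodSubOne, map_sub]
  exact norm_sub_le _ _

theorem tsum_coeff_prodSubOne [CompleteSpace A] (x y : A) :
    ∑' n, coeff n (prodSubOne x y) = NormedSpace.exp x * NormedSpace.exp y - 1 := by
  have he : ∀ x : A, ∑' n, coeff n (expPS x) = NormedSpace.exp x := fun x => by
    simp only [coeff_expPS]
    exact (NormedSpace.exp_series_hasSum_exp' (𝕂 := ℝ) x).tsum_eq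
  have h1 : HasSum (fun n => coeff n (1 : A⟦X⟧)) 1 := by
    simp only [coeff_one]
    exact hasSum_ite_eq 0 1
  simp only [prodSubOne, map_sub]
  rw [Summable.tsum_sub _ h1.summable, h1.tsum_eq,
    tsum_coeff_mul (summable_norm_coeff_expPS x) (summable_norm_coeff_expPS y), he, he]
  exact (summable_norm_coeff_mul (summable_norm_coeff_expPS x)
    (summable_norm_coeff_expPS y)).of_norm

theorem tsum_norm_coeff_prodSubOne_le (x y : A) :
    ∑' n, ‖coeff n (prodSubOne x y)‖ ≤ Real.exp (‖x‖ + ‖y‖) - 1 := by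
  have h1 := (NormedSpace.exp_series_hasSum_exp' (𝕂 := ℝ) (‖x‖ + ‖y‖)).sub
    (hasSum_ite_eq (0 : ℕ) (1 : ℝ))
  rw [← Real.exp_eq_exp_ℝ] at h1
  refine hasSum_le (fun n => ?_) (summable_norm_coeff_prodSubOne x y).hasSum h1
  rcases Nat.eq_zero_or_pos n with rfl | hn
  · simp [constantCoeff_prodSubOne]
  · rw [prodSubOne, map_sub, coeff_one, if_neg hn.ne', if_neg hn.ne', sub_zero, sub_zero]
    exact norm_coeff_expPS_mul_le x y hn.ne'

/-- On series with summable coefficients the sum of norms is submultiplicative, and evaluation at X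
= 1 is multiplicative (Cauchy product). -/
theorem prodSubOne_pow_bounds [CompleteSpace A] (x y : A) (k : ℕ) :
    (Summable fun n => ‖coeff n (prodSubOne x y ^ (k + 1))‖) ∧
    ∑' n, ‖coeff n (prodSubOne x y ^ (k + 1))‖ ≤ (Real.exp (‖x‖ + ‖y‖) - 1) ^ (k + 1) ∧
    ∑' n, coeff n (prodSubOne x y ^ (k + 1)) =
      (NormedSpace.exp x * NormedSpace.exp y - 1) ^ (k + 1) := by
  induction k with
  | zero =>
    simp only [zero_add, pow_one]
    exact ⟨summable_norm_coeff_prodSubOne x y, tsum_norm_coeff_prodSubOne_le x y,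
      tsum_coeff_prodSubOne x y⟩
  | succ k ih =>
    obtain ⟨h1, h2, h3⟩ := ih
    have hP := summable_norm_coeff_prodSubOne x y
    have hb := tsum_norm_coeff_prodSubOne_le x y
    simp only [pow_succ _ (k + 1)]
    refine ⟨summable_norm_coeff_mul h1 hP, (tsum_norm_coeff_mul_le h1 hP).trans ?_, ?_⟩
    · exact mul_le_mul h2 hb (tsum_nonneg fun _ => norm_nonneg _)
        ((tsum_nonneg fun _ => norm_nonneg _).trans h2)
    · rw [tsum_coeff_mul h1 hP, h3, tsum_coeff_prodSubOne]

theorem mercatorTerm_succ (x y : A) (k : ℕ) : mercatorTerm ℝ x y (k + 1) =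
    ((-1 : ℝ) ^ k / (k + 1)) • (NormedSpace.exp x * NormedSpace.exp y - 1) ^ (k + 1) := by
  rw [mercatorTerm, pow_succ, pow_succ]
  push_cast
  simp

theorem absolutelyConvergent_and_eq [CompleteSpace A] {x y : A}
    (hxy : ‖x‖ + ‖y‖ < Real.log 2) :
    AbsolutelyConvergent (mercatorTerm ℝ x y) ∧ AbsolutelyConvergent (bchTerm ℝ x y) ∧
    ∃ S : A, SeriesConvergesTo (mercatorTerm ℝ x y) S ∧ SeriesConvergesTo (bchTerm ℝ x y) S := by
  set q := Real.exp (‖x‖ + ‖y‖) - 1 with hq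
  have hq0 : 0 ≤ q := by
    rw [hq, sub_nonneg]; exact Real.one_le_exp (by positivity)
  have hq1 : q < 1 := by
    have := (Real.lt_log_iff_exp_lt two_pos).1 hxy
    linarith
  set F : ℕ × ℕ → A := fun p =>
    ((-1 : ℝ) ^ p.1 / (p.1 + 1)) • coeff p.2 (prodSubOne x y ^ (p.1 + 1)) with hF
  have hc : ∀ k : ℕ, ‖((-1 : ℝ) ^ k / (k + 1))‖ ≤ 1 := fun k => by
    rw [norm_div, norm_pow, norm_neg, norm_one, one_pow, Real.norm_of_nonneg (by positivity)]
    exact div_le_one_of_le₀ (by linarith [k.cast_nonneg (α := ℝ)]) (by positivity)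
  have hFn : Summable fun p => ‖F p‖ := by
    rw [summable_prod_of_nonneg fun p => norm_nonneg _]
    simp only [hF, norm_smul, tsum_mul_left]
    refine ⟨fun k => (prodSubOne_pow_bounds x y k).1.mul_left _, ?_⟩
    refine Summable.of_nonneg_of_le
      (fun k => mul_nonneg (norm_nonneg _) (tsum_nonneg fun _ => norm_nonneg _)) (fun k => ?_)
      ((summable_geometric_of_lt_one hq0 hq1).mul_left q)
    rw [← pow_succ']
    refine (mul_le_of_le_one_left (tsum_nonneg fun _ => norm_nonneg _) (hc k)).trans
      (prodSubOne_pow_bounds x y k).2.1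
  have hL : ∀ k, ∑' n, F (k, n) = mercatorTerm ℝ x y (k + 1) := fun k => by
    rw [mercatorTerm_succ, ← (prodSubOne_pow_bounds x y k).2.2, ← tsum_const_smul'']
  -- Only k < n contributes, since P^{k+1} has order at least k + 1.
  have hZ : ∀ n, ∑' k, F (k, n) = bchTerm ℝ x y n := fun n => by
    rw [bchTerm_eq_sum_coeff]
    refine tsum_eq_sum fun k hk => ?_
    simp only [hF]
    rw [coeff_of_lt_order, smul_zero]
    refine lt_of_lt_of_le ?_
      (le_order_pow_of_constantCoeff_eq_zero _ (constantCoeff_prodSubOne x y))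
    rw [Finset.mem_range, not_lt] at hk
    exact_mod_cast Nat.lt_succ_of_le hk
  have hFn' : Summable fun p : ℕ × ℕ => ‖F p.swap‖ := hFn.prod_symm
  have hML : AbsolutelyConvergent (mercatorTerm ℝ x y) := by
    have h2 : Summable fun k => ∑' n, ‖F (k, n)‖ := hFn.prod
    refine Summable.of_nonneg_of_le (fun n => norm_nonneg _) (fun k => ?_) h2
    rw [← hL]
    exact norm_tsum_le_tsum_norm (hFn.prod_factor k)
  have hZs : Summable fun n => ‖bchTerm ℝ x y n‖ := by
    have h2 : Summable fun n => ∑' k, ‖F (k, n)‖ := hFn'.prod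
    refine Summable.of_nonneg_of_le (fun n => norm_nonneg _) (fun k => ?_) h2
    rw [← hZ]
    exact norm_tsum_le_tsum_norm (hFn'.prod_factor k)
  have hMZ : AbsolutelyConvergent (bchTerm ℝ x y) := (summable_nat_add_iff 1).2 hZs
  refine ⟨hML, hMZ, _, hML.seriesConvergesTo, ?_⟩
  have hS : ∑' n, bchTerm ℝ x y (n + 1) = ∑' k, mercatorTerm ℝ x y (k + 1) := by
    have h0 := hZs.of_norm.tsum_eq_zero_add
    rw [show bchTerm ℝ x y 0 = 0 by simp [bchTerm], zero_add] at h0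
    rw [← h0, ← tsum_congr hL, ← tsum_congr hZ]
    exact (Summable.tsum_comm (f := fun k n => F (k, n)) hFn.of_norm)
  rw [← hS]
  exact hMZ.seriesConvergesTo

end Absolute

end BCH

namespace BCH

open PowerSeries Filter Topology

/-! ### Abel's limit theorem, analyticity and the exponential along commuting curves -/

section PowerSum

variable {A : Type*} [NormedRing A]

theorem SeriesConvergesTo.tendsto_sum_range {a : ℕ → A} {S : A} (h : SeriesConvergesTo a S) :
    Tendsto (fun N => ∑ n ∈ Finset.range N, a (n + 1)) atTop (𝓝 S) := by
  simpa only [SeriesConvergesTo, sum_Icc_one] using h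

theorem SeriesConvergesTo.exists_norm_le {a : ℕ → A} {S : A} (h : SeriesConvergesTo a S) :
    ∃ C : ℝ, ∀ n, ‖a (n + 1)‖ ≤ C := by
  have h1 := h.tendsto_sum_range
  have h2 := ((tendsto_add_atTop_iff_nat 1).2 h1).sub h1
  simp only [Finset.sum_range_succ, add_sub_cancel_left] at h2
  obtain ⟨C, hC⟩ := (Metric.isBounded_range_of_tendsto _ h2).exists_norm_le
  exact ⟨C, fun n => hC _ ⟨n, rfl⟩⟩

variable [NormedAlgebra ℝ A]

/-- The function `r ↦ ∑_{n ≥ 1} rⁿ aₙ`. -/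
noncomputable def powSum (a : ℕ → A) (r : ℝ) : A :=
  ∑' n : ℕ, r ^ (n + 1) • a (n + 1)

theorem summable_norm_pow_smul {b : ℕ → A} {C : ℝ} (hb : ∀ n, ‖b n‖ ≤ C) {r : ℝ}
    (hr : |r| < 1) : Summable fun n => ‖r ^ n • b n‖ := by
  refine Summable.of_nonneg_of_le (fun n => norm_nonneg _) (fun n => ?_)
    ((summable_geometric_of_lt_one (abs_nonneg r) hr).mul_right C)
  rw [norm_smul, norm_pow, Real.norm_eq_abs]
  exact mul_le_mul_of_nonneg_left (hb n) (by positivity)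

theorem powSum_eq_smul (a : ℕ → A) (r : ℝ) : powSum a r = r • ∑' n : ℕ, r ^ n • a (n + 1) := by
  simp only [powSum, pow_succ', mul_smul]
  exact tsum_const_smul'' r

/-- The weights (1 - r) r^n have total mass 1. The tail, where e_n ≤ ε/2, contributes at most ε/2,
and the finite head at most (1 - r)E, which tends to 0. -/
theorem tendsto_one_sub_mul_tsum {e : ℕ → ℝ} (he0 : ∀ n, 0 ≤ e n)
    (he : Tendsto e atTop (𝓝 0)) :
    Tendsto (fun r : ℝ => (1 - r) * ∑' n, r ^ n * e n) (𝓝[<] 1) (𝓝 0) := by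
  obtain ⟨C, hC⟩ := (Metric.isBounded_range_of_tendsto _ he).exists_norm_le
  have hC' : ∀ n, ‖e n‖ ≤ C := fun n => hC _ ⟨n, rfl⟩
  rw [Metric.tendsto_nhds]
  intro ε hε
  obtain ⟨N, hN⟩ := eventually_atTop.1 (he.eventually (ge_mem_nhds (half_pos hε)))
  set E := ∑ n ∈ Finset.range N, e n with hE
  have h1 : ∀ᶠ r : ℝ in 𝓝[<] 1, (1 - r) * E < ε / 2 := by
    have : Tendsto (fun r : ℝ => (1 - r) * E) (𝓝[<] 1) (𝓝 ((1 - 1) * E)) :=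
      ((continuous_const.sub continuous_id).mul continuous_const).continuousWithinAt
    rw [sub_self, zero_mul] at this
    exact this.eventually (gt_mem_nhds (half_pos hε))
  filter_upwards [h1, Ioo_mem_nhdsLT (zero_lt_one' ℝ)] with r hr1 hr
  have hg := (hasSum_geometric_of_lt_one hr.1.le hr.2).mul_right (ε / 2)
  have hf := hasSum_sum_of_ne_finset_zero (L := SummationFilter.unconditional ℕ)
    (f := fun n => if n < N then e n else 0) (s := Finset.range N)
    (fun n hn => if_neg (by simpa using hn))
  rw [Finset.sum_congr rfl fun n hn => if_pos (Finset.mem_range.1 hn)] at hf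
  have hs : Summable fun n => r ^ n * e n := by
    simpa only [smul_eq_mul] using
      (summable_norm_pow_smul hC' (by rw [abs_of_pos hr.1]; exact hr.2)).of_norm
  have hle : ∑' n, r ^ n * e n ≤ (1 - r)⁻¹ * (ε / 2) + E := by
    refine hasSum_le (fun n => ?_) hs.hasSum (hg.add hf)
    have hp : 0 ≤ r ^ n := pow_nonneg hr.1.le n
    have hp1 : r ^ n ≤ 1 := pow_le_one₀ hr.1.le hr.2.le
    split_ifs with h
    · nlinarith [he0 n, mul_nonneg hp hε.le]
    · have := mul_le_mul_of_nonneg_left (hN n (not_lt.1 h)) hp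
      linarith
  have h0 : 0 ≤ ∑' n, r ^ n * e n := tsum_nonneg fun n => mul_nonneg (pow_nonneg hr.1.le n) (he0 n)
  have hr' : 0 < 1 - r := sub_pos.2 hr.2
  rw [Real.dist_0_eq_abs, abs_of_nonneg (mul_nonneg hr'.le h0)]
  have := mul_le_mul_of_nonneg_left hle hr'.le
  rw [mul_add, mul_inv_cancel_left₀ hr'.ne'] at this
  linarith

/-- Abel's limit theorem in a Banach algebra. -/
theorem SeriesConvergesTo.tendsto_powSum [CompleteSpace A] {a : ℕ → A} {S : A}
    (h : SeriesConvergesTo a S) : Tendsto (powSum a) (𝓝[<] 1) (𝓝 S) := by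
  set s : ℕ → A := fun N => ∑ n ∈ Finset.range N, a (n + 1) with hs
  have h1 : Tendsto s atTop (𝓝 S) := h.tendsto_sum_range
  have h1' : Tendsto (fun n => s (n + 1)) atTop (𝓝 S) := (tendsto_add_atTop_iff_nat 1).2 h1
  obtain ⟨C, hC⟩ := (Metric.isBounded_range_of_tendsto _ h1').exists_norm_le
  have hC' : ∀ n, ‖s (n + 1)‖ ≤ C := fun n => hC _ ⟨n, rfl⟩
  have he : Tendsto (fun n => ‖s (n + 1) - S‖) atTop (𝓝 0) :=
    tendsto_iff_norm_sub_tendsto_zero.1 h1'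
  have hlim := tendsto_one_sub_mul_tsum (fun n => norm_nonneg (s (n + 1) - S)) he
  have hg : Tendsto (fun r : ℝ => ∑' n : ℕ, r ^ n • a (n + 1)) (𝓝[<] 1) (𝓝 S) := by
    rw [tendsto_iff_norm_sub_tendsto_zero]
    refine squeeze_zero' (Eventually.of_forall fun r => norm_nonneg _) ?_ hlim
    filter_upwards [Ioo_mem_nhdsLT (zero_lt_one' ℝ)] with r hr
    have hr1 : |r| < 1 := by rw [abs_of_pos hr.1]; exact hr.2
    have hr' : 0 < 1 - r := sub_pos.2 hr.2
    have hsum : Summable fun n => r ^ n • s (n + 1) := (summable_norm_pow_smul hC' hr1).of_norm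
    have hsum' : Summable fun n => r ^ n • s n := by
      rw [← summable_nat_add_iff 1]
      simpa only [pow_succ', mul_smul] using hsum.const_smul r
    -- Summation by parts: the series becomes a weighted mean of its partial sums.
    have e1 : ∑' n : ℕ, r ^ n • a (n + 1) = (1 - r) • ∑' n : ℕ, r ^ n • s (n + 1) := by
      have e2 : ∀ n, r ^ n • a (n + 1) = r ^ n • s (n + 1) - r ^ n • s n := fun n => by
        rw [← smul_sub, hs]
        simp only [Finset.sum_range_succ, add_sub_cancel_left]
      have e3 : ∑' n, r ^ n • s n = r • ∑' n : ℕ, r ^ n • s (n + 1) := by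
        rw [hsum'.tsum_eq_zero_add, ← tsum_const_smul'']
        simp [hs, pow_succ', mul_smul]
      rw [tsum_congr e2, hsum.tsum_sub hsum', e3, sub_smul, one_smul]
    have hgeo : HasSum (fun n => r ^ n • S) ((1 - r)⁻¹ • S) :=
      (hasSum_geometric_of_lt_one hr.1.le hr.2).smul_const S
    have e4 : ∑' n : ℕ, r ^ n • a (n + 1) - S = (1 - r) • ∑' n : ℕ, r ^ n • (s (n + 1) - S) := by
      simp only [smul_sub]
      rw [hsum.tsum_sub hgeo.summable, hgeo.tsum_eq, smul_sub, e1, smul_inv_smul₀ hr'.ne']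
    rw [e4, norm_smul, Real.norm_of_nonneg hr'.le]
    refine mul_le_mul_of_nonneg_left ?_ hr'.le
    have hn : ∀ n, ‖r ^ n • (s (n + 1) - S)‖ = r ^ n * ‖s (n + 1) - S‖ := fun n => by
      rw [norm_smul, Real.norm_of_nonneg (pow_nonneg hr.1.le n)]
    have hns : Summable fun n => ‖r ^ n • (s (n + 1) - S)‖ := by
      refine summable_norm_pow_smul (C := C + ‖S‖) (fun n => ?_) hr1
      exact (norm_sub_le _ _).trans (by gcongr; exact hC' n)
    refine (norm_tsum_le_tsum_norm hns).trans_eq ?_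
    simp only [hn]
  have hid : Tendsto (fun r : ℝ => r) (𝓝[<] 1) (𝓝 1) := tendsto_id.mono_left nhdsWithin_le_nhds
  have := hid.smul hg
  rw [one_smul] at this
  refine this.congr fun r => ?_
  rw [powSum_eq_smul]

theorem SeriesConvergesTo.seriesConvergesTo_powSum [CompleteSpace A] {a : ℕ → A} {S : A}
    (h : SeriesConvergesTo a S) {r : ℝ} (hr : |r| < 1) :
    SeriesConvergesTo (fun n => r ^ n • a n) (powSum a r) := by
  obtain ⟨C, hC⟩ := h.exists_norm_le
  have hs := (summable_norm_pow_smul hC hr).mul_left |r|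
  refine AbsolutelyConvergent.seriesConvergesTo ?_
  refine hs.congr fun n => ?_
  change |r| * ‖r ^ n • a (n + 1)‖ = ‖r ^ (n + 1) • a (n + 1)‖
  rw [pow_succ', mul_smul, norm_smul r, Real.norm_eq_abs]

theorem SeriesConvergesTo.analyticOnNhd_powSum [CompleteSpace A] {a : ℕ → A} {S : A}
    (h : SeriesConvergesTo a S) : AnalyticOnNhd ℝ (powSum a) (Metric.ball 0 1) := by
  obtain ⟨C, hC⟩ := h.exists_norm_le
  set p : FormalMultilinearSeries ℝ ℝ A :=
    fun n => ContinuousMultilinearMap.mkPiRing ℝ (Fin n) (a (n + 1)) with hp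
  have hrad : 1 ≤ p.radius := by
    have := p.le_radius_of_bound (r := 1) C fun n => by
      simpa [hp] using hC n
    simpa using this
  have hb := (p.hasFPowerSeriesOnBall (lt_of_lt_of_le one_pos hrad)).analyticOnNhd
  have hsum : powSum a = fun r => r • p.sum r := by
    ext r
    rw [powSum_eq_smul]
    simp [FormalMultilinearSeries.sum, hp]
  rw [hsum]
  intro r hr
  refine analyticAt_id.smul (hb r ?_)
  refine Metric.eball_subset_eball hrad ?_
  rw [← ENNReal.ofReal_one, Metric.eball_ofReal]
  exact hr

/-- Commutativity gives exp(f s) = exp(f r) exp(f s - f r), so only the derivative of exp at 0 is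
needed. -/
theorem hasDerivAt_exp_comp_of_commute [CompleteSpace A] {f : ℝ → A} {f' : A} {r : ℝ}
    (hf : HasDerivAt f f' r) (hc : ∀ s, Commute (f r) (f s)) :
    HasDerivAt (fun s => NormedSpace.exp (f s)) (NormedSpace.exp (f r) * f') r := by
  have e : (fun s => NormedSpace.exp (f s)) =
      fun s => NormedSpace.exp (f r) * NormedSpace.exp (f s - f r) := by
    ext s
    have hcomm : Commute (f r) (f s - f r) := (hc s).sub_right (Commute.refl _)
    let _ : NormedAlgebra ℚ A := NormedAlgebra.restrictScalars ℚ ℝ A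
    rw [← NormedSpace.exp_add_of_commute hcomm, add_sub_cancel]
  rw [e]
  have h0 : HasFDerivAt (NormedSpace.exp : A → A) (1 : A →L[ℝ] A) (f r - f r) := by
    rw [sub_self]; exact hasFDerivAt_exp_zero
  have h1 : HasDerivAt (fun s => NormedSpace.exp (f s - f r)) f' r := by
    exact h0.comp_hasDerivAt r (hf.sub_const (f r))
  exact h1.const_mul _

end PowerSum

end BCH

namespace BCH

open PowerSeries Filter Topology

/-! ### The sums are logarithms -/

section Logarithm

variable {A : Type*} [NormedRing A] [NormedAlgebra ℝ A]

/-- The derivative of `log (1 + r u)` computed termwise from the Mercator series. -/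
theorem exists_hasDerivAt_powSum [CompleteSpace A] {a : ℕ → A} {C : ℝ} (u : A)
    (ha : ∀ n, a (n + 1) = ((-1 : ℝ) ^ n / (n + 1)) • u ^ (n + 1))
    (hC : ∀ n, ‖a (n + 1)‖ ≤ C) {r : ℝ} (hr : |r| < 1) :
    ∃ D : A, HasDerivAt (powSum a) D r ∧ D * (1 + r • u) = u := by
  -- On the ball of radius ρ the termwise derivatives are dominated by (n + 1) ρ^n C, which is
  -- summable.
  obtain ⟨ρ, hrρ, hρ⟩ := exists_between hr
  have hρ0 : 0 < ρ := (abs_nonneg r).trans_lt hrρ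
  have hbound : Summable fun n : ℕ => ((n : ℝ) + 1) * ρ ^ n * C := by
    have h1 := summable_pow_mul_geometric_of_norm_lt_one (R := ℝ) 1
      (r := ρ) (by rwa [Real.norm_of_nonneg hρ0.le])
    have h2 := summable_geometric_of_lt_one hρ0.le hρ
    refine ((h1.add h2).mul_right C).congr fun n => ?_
    ring
  have hd : ∀ (n : ℕ) (s : ℝ), s ∈ Metric.ball (0 : ℝ) ρ →
      HasDerivAt (fun s : ℝ => s ^ (n + 1) • a (n + 1)) ((((n : ℝ) + 1) * s ^ n) • a (n + 1)) s := by
    intro n s _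
    have := (hasDerivAt_pow (n + 1) s).smul_const (a (n + 1))
    simpa using this
  have hle : ∀ (n : ℕ) (s : ℝ), s ∈ Metric.ball (0 : ℝ) ρ →
      ‖(((n : ℝ) + 1) * s ^ n) • a (n + 1)‖ ≤ ((n : ℝ) + 1) * ρ ^ n * C := by
    intro n s hs
    rw [mem_ball_zero_iff, Real.norm_eq_abs] at hs
    rw [norm_smul, norm_mul, norm_pow, Real.norm_eq_abs, Real.norm_eq_abs,
      abs_of_nonneg (by positivity)]
    have := hC n
    gcongr
  have hball : ∀ {s : ℝ}, |s| < ρ → s ∈ Metric.ball (0 : ℝ) ρ := fun h => by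
    rwa [mem_ball_zero_iff, Real.norm_eq_abs]
  have hmain := hasDerivAt_tsum_of_isPreconnected hbound Metric.isOpen_ball
    (convex_ball (0 : ℝ) ρ).isPreconnected hd hle (hball (s := 0) (by simpa using hρ0))
    (by simp) (hball hrρ)
  have hterm : ∀ n : ℕ, (((n : ℝ) + 1) * r ^ n) • a (n + 1) = (-r) ^ n • u ^ (n + 1) := by
    intro n
    rw [ha, smul_smul]
    congr 1
    have : (n : ℝ) + 1 ≠ 0 := by positivity
    rw [neg_pow r]
    field_simp
  have hsum : Summable fun n : ℕ => (-r) ^ n • u ^ (n + 1) := by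
    refine (Summable.of_norm_bounded hbound fun n => hle n r (hball hrρ)).congr fun n => ?_
    rw [hterm]
  refine ⟨_, hmain, ?_⟩
  simp only [hterm]
  -- With D = Σ (-r)^n u^{n+1}, the product D(1 + ru) telescopes to u.
  have h0 := hsum.tsum_eq_zero_add
  simp only [pow_zero, one_smul, zero_add, pow_one] at h0
  rw [mul_add, mul_one, ← hsum.tsum_mul_right]
  have h3 : ∀ n : ℕ, (-r) ^ n • u ^ (n + 1) * r • u = -((-r) ^ (n + 1) • u ^ (n + 1 + 1)) := by
    intro n
    rw [smul_mul_smul_comm, ← pow_succ, ← neg_smul]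
    congr 1
    ring
  rw [tsum_congr h3, tsum_neg]
  nth_rewrite 1 [h0]
  abel

theorem commute_powSum [CompleteSpace A] {a : ℕ → A} {v : A} (h : ∀ n, Commute v (a (n + 1)))
    (r : ℝ) : Commute v (powSum a r) :=
  Commute.tsum_right v fun n => (h n).smul_right _

/-- Writing ℓ for `powSum a`, the function exp(-ℓ(s))(1 + su) has derivative exp(-ℓ(s))(u - ℓ'(s)(1
+ su)) = 0 and equals 1 at s = 0. -/
theorem exp_powSum_of_mercator [CompleteSpace A] {a : ℕ → A} {C : ℝ} (u : A)
    (ha : ∀ n, a (n + 1) = ((-1 : ℝ) ^ n / (n + 1)) • u ^ (n + 1))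
    (hC : ∀ n, ‖a (n + 1)‖ ≤ C) {r : ℝ} (hr : |r| < 1) :
    NormedSpace.exp (powSum a r) = 1 + r • u := by
  let _ : NormedAlgebra ℚ A := NormedAlgebra.restrictScalars ℚ ℝ A
  have hu : ∀ s, Commute u (powSum a s) := commute_powSum fun n => by
    rw [ha]; exact ((Commute.refl u).pow_right _).smul_right _
  have hcomm : ∀ s t, Commute (powSum a s) (powSum a t) := fun s t =>
    commute_powSum (fun n => by
      rw [ha]; exact ((hu s).symm.pow_right _).smul_right _) t
  set h : ℝ → A := fun s => NormedSpace.exp (-powSum a s) * (1 + s • u) with hh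
  have hder : ∀ s ∈ Metric.ball (0 : ℝ) 1, HasDerivAt h 0 s := by
    intro s hs
    rw [mem_ball_zero_iff, Real.norm_eq_abs] at hs
    obtain ⟨D, hD, hDu⟩ := exists_hasDerivAt_powSum u ha hC hs
    have h1 := hasDerivAt_exp_comp_of_commute (f := fun s => -powSum a s) hD.neg
      (fun t => ((hcomm s t).neg_left).neg_right)
    have h2 : HasDerivAt (fun s : ℝ => 1 + s • u) u s := by
      simpa using ((hasDerivAt_id s).smul_const u).const_add 1
    have h3 := h1.mul h2
    rw [mul_assoc, neg_mul, hDu, mul_neg, neg_add_cancel] at h3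
    exact h3
  have hconst : h r = h 0 :=
    Metric.isOpen_ball.is_const_of_deriv_eq_zero (convex_ball (0 : ℝ) 1).isPreconnected
      (fun s hs => (hder s hs).differentiableAt.differentiableWithinAt)
      (fun s hs => (hder s hs).deriv) (by simpa using hr) (by simp)
  have h0 : powSum a 0 = 0 := by simp [powSum]
  have e : NormedSpace.exp (-powSum a r) * (1 + r • u) = 1 := by
    have : h 0 = 1 := by simp [hh, h0]
    exact hconst.trans this
  have hinv : NormedSpace.exp (powSum a r) * NormedSpace.exp (-powSum a r) = 1 := by
    rw [← NormedSpace.exp_add_of_commute ((Commute.refl _).neg_right), add_neg_cancel,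
      NormedSpace.exp_zero]
  calc NormedSpace.exp (powSum a r)
      = NormedSpace.exp (powSum a r) * (NormedSpace.exp (-powSum a r) * (1 + r • u)) := by
        rw [e, mul_one]
    _ = 1 + r • u := by rw [← mul_assoc, hinv, one_mul]

theorem isLogarithm_of_mercator [CompleteSpace A] {x y L : A}
    (h : SeriesConvergesTo (mercatorTerm ℝ x y) L) :
    IsLogarithm L (NormedSpace.exp x * NormedSpace.exp y) := by
  let _ : NormedAlgebra ℚ A := NormedAlgebra.restrictScalars ℚ ℝ A
  obtain ⟨C, hC⟩ := h.exists_norm_le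
  set u := NormedSpace.exp x * NormedSpace.exp y - 1 with hu
  have h1 : Tendsto (fun r => NormedSpace.exp (powSum (mercatorTerm ℝ x y) r)) (𝓝[<] 1)
      (𝓝 (NormedSpace.exp L)) :=
    (NormedSpace.exp_continuous.tendsto L).comp h.tendsto_powSum
  have h2 : Tendsto (fun r : ℝ => 1 + r • u) (𝓝[<] 1) (𝓝 (1 + (1 : ℝ) • u)) :=
    (continuous_const.add (continuous_id.smul continuous_const)).continuousWithinAt
  have h3 := h1.congr' (f₂ := fun r : ℝ => 1 + r • u) <| by
    filter_upwards [Ioo_mem_nhdsLT (zero_lt_one' ℝ)] with r hr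
    exact exp_powSum_of_mercator u (mercatorTerm_succ x y) hC
      (by rw [abs_of_pos hr.1]; exact hr.2)
  have := tendsto_nhds_unique h3 h2
  rw [IsLogarithm, this, one_smul, hu, add_sub_cancel]

theorem coeff_prodSubOne_smul_pow (x y : A) (r : ℝ) (k n : ℕ) :
    coeff n (prodSubOne (r • x) (r • y) ^ k) = r ^ n • coeff n (prodSubOne x y ^ k) := by
  have hmul : ∀ f f' g g' : A⟦X⟧, (∀ n, coeff n f' = r ^ n • coeff n f) →
      (∀ n, coeff n g' = r ^ n • coeff n g) → ∀ n, coeff n (f' * g') = r ^ n • coeff n (f * g) := by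
    intro f f' g g' hf hg n
    rw [coeff_mul, coeff_mul, Finset.smul_sum]
    refine Finset.sum_congr rfl fun p hp => ?_
    rw [hf, hg, smul_mul_smul_comm, ← pow_add, Finset.HasAntidiagonal.mem_antidiagonal.1 hp]
  have hone : ∀ n, coeff n (1 : A⟦X⟧) = r ^ n • coeff n (1 : A⟦X⟧) := fun n => by
    rw [coeff_one]; split_ifs with h <;> simp [h]
  have hexp : ∀ (z : A) n, coeff n (expPS (r • z)) = r ^ n • coeff n (expPS z) := fun z n => by
    rw [coeff_expPS, coeff_expPS, smul_pow, smul_comm]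
  have hP : ∀ n, coeff n (prodSubOne (r • x) (r • y)) = r ^ n • coeff n (prodSubOne x y) := by
    intro n
    rw [prodSubOne, prodSubOne, map_sub, map_sub, smul_sub, ← hone,
      hmul _ _ _ _ (hexp x) (hexp y)]
  induction k generalizing n with
  | zero => simpa using hone n
  | succ k ih => rw [pow_succ, pow_succ]; exact hmul _ _ _ _ ih hP n

theorem bchTerm_smul (x y : A) (r : ℝ) (n : ℕ) :
    bchTerm ℝ (r • x) (r • y) n = r ^ n • bchTerm ℝ x y n := by
  simp only [bchTerm_eq_sum_coeff, coeff_prodSubOne_smul_pow, Finset.smul_sum]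
  exact Finset.sum_congr rfl fun k _ => smul_comm _ _ _

theorem isLogarithm_of_bch [CompleteSpace A] {x y Z : A}
    (h : SeriesConvergesTo (bchTerm ℝ x y) Z) :
    IsLogarithm Z (NormedSpace.exp x * NormedSpace.exp y) := by
  let _ : NormedAlgebra ℚ A := NormedAlgebra.restrictScalars ℚ ℝ A
  have hleft : AnalyticOnNhd ℝ (fun r => NormedSpace.exp (powSum (bchTerm ℝ x y) r))
      (Metric.ball 0 1) := fun r hr =>
    (NormedSpace.exp_analytic (𝕂 := ℝ) _).comp (h.analyticOnNhd_powSum r hr)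
  have hexp : ∀ z : A, AnalyticOnNhd ℝ (fun r : ℝ => NormedSpace.exp (r • z)) (Metric.ball 0 1) :=
    fun z r _ => (NormedSpace.exp_analytic (𝕂 := ℝ) _).comp (analyticAt_id.smul analyticAt_const)
  have hright : AnalyticOnNhd ℝ (fun r : ℝ => NormedSpace.exp (r • x) * NormedSpace.exp (r • y))
      (Metric.ball 0 1) := fun r hr => (hexp x r hr).mul (hexp y r hr)
  -- For small r the pair (rx, ry) satisfies the bound of part (a), so its BCH sum is also its
  -- Mercator sum, hence a logarithm.
  have hlocal : (fun r => NormedSpace.exp (powSum (bchTerm ℝ x y) r)) =ᶠ[𝓝 0]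
      fun r : ℝ => NormedSpace.exp (r • x) * NormedSpace.exp (r • y) := by
    have hcont : Tendsto (fun r : ℝ => |r| * (‖x‖ + ‖y‖)) (𝓝 0) (𝓝 (|0| * (‖x‖ + ‖y‖))) :=
      (continuous_abs.mul continuous_const).tendsto 0
    rw [abs_zero, zero_mul] at hcont
    filter_upwards [hcont.eventually (gt_mem_nhds (Real.log_pos one_lt_two)),
      Metric.ball_mem_nhds (0 : ℝ) one_pos] with r hr hr1
    rw [mem_ball_zero_iff, Real.norm_eq_abs] at hr1
    have hsmall : ‖r • x‖ + ‖r • y‖ < Real.log 2 := by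
      rwa [norm_smul, norm_smul, ← mul_add, Real.norm_eq_abs]
    obtain ⟨-, -, S, hS1, hS2⟩ := absolutelyConvergent_and_eq hsmall
    have e : bchTerm ℝ (r • x) (r • y) = fun n => r ^ n • bchTerm ℝ x y n :=
      funext fun n => bchTerm_smul x y r n
    rw [e] at hS2
    rw [tendsto_nhds_unique (h.seriesConvergesTo_powSum hr1) hS2]
    exact isLogarithm_of_mercator hS1
  have heq := hleft.eqOn_of_preconnected_of_eventuallyEq hright
    (convex_ball (0 : ℝ) 1).isPreconnected (Metric.mem_ball_self one_pos) hlocal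
  have h1 : Tendsto (fun r => NormedSpace.exp (powSum (bchTerm ℝ x y) r)) (𝓝[<] 1)
      (𝓝 (NormedSpace.exp Z)) :=
    (NormedSpace.exp_continuous.tendsto Z).comp h.tendsto_powSum
  have hc : ∀ z : A, Continuous fun r : ℝ => NormedSpace.exp (r • z) := fun z =>
    NormedSpace.exp_continuous.comp (continuous_id.smul continuous_const)
  have h2 : Tendsto (fun r : ℝ => NormedSpace.exp (r • x) * NormedSpace.exp (r • y)) (𝓝[<] 1)
      (𝓝 (NormedSpace.exp ((1 : ℝ) • x) * NormedSpace.exp ((1 : ℝ) • y))) :=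
    ((hc x).mul (hc y)).continuousWithinAt
  rw [one_smul, one_smul] at h2
  refine tendsto_nhds_unique (h1.congr' ?_) h2
  filter_upwards [Ioo_mem_nhdsLT (zero_lt_one' ℝ)] with r hr
  refine heq ?_
  rw [mem_ball_zero_iff, Real.norm_eq_abs, abs_of_pos hr.1]
  exact hr.2

end Logarithm

/-! ### Reduction to real scalars: all coefficients of both series are rational -/

section Scalars

variable {𝕜 : Type*} [RCLike 𝕜] {A : Type*} [NormedRing A] [NormedAlgebra 𝕜 A]
  [NormedAlgebra ℝ A] [IsScalarTower ℝ 𝕜 A]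

theorem mercatorTerm_eq_real (x y : A) : mercatorTerm 𝕜 x y = mercatorTerm ℝ x y := by
  ext n
  rw [mercatorTerm, mercatorTerm, ← algebraMap_smul 𝕜 ((-1 : ℝ) ^ (n + 1) / (n : ℝ))]
  simp

theorem bchTerm_eq_real (x y : A) : bchTerm 𝕜 x y = bchTerm ℝ x y := by
  ext n
  simp only [bchTerm, ← algebraMap_smul 𝕜 (_ : ℝ) (_ : A)]
  simp

end Scalars

end BCH

theorem proposition2p2 {𝕜 : Type*} [RCLike 𝕜] {A : Type*} [NormedRing A] [NormedAlgebra 𝕜 A]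
    [CompleteSpace A] (x y : A) :
    (‖x‖ + ‖y‖ < Real.log 2 →
      BCH.AbsolutelyConvergent (BCH.mercatorTerm 𝕜 x y) ∧
      BCH.AbsolutelyConvergent (BCH.bchTerm 𝕜 x y) ∧
      ∃ S : A, BCH.SeriesConvergesTo (BCH.mercatorTerm 𝕜 x y) S ∧
        BCH.SeriesConvergesTo (BCH.bchTerm 𝕜 x y) S) ∧
    (∀ L : A, BCH.SeriesConvergesTo (BCH.mercatorTerm 𝕜 x y) L →
      BCH.IsLogarithm L (NormedSpace.exp x * NormedSpace.exp y)) ∧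
    (∀ Z : A, BCH.SeriesConvergesTo (BCH.bchTerm 𝕜 x y) Z →
      BCH.IsLogarithm Z (NormedSpace.exp x * NormedSpace.exp y)) := by
  let _ : NormedAlgebra ℝ A := NormedAlgebra.restrictScalars ℝ 𝕜 A
  have : IsScalarTower ℝ 𝕜 A := IsScalarTower.of_algebraMap_smul fun _ _ => rfl
  rw [BCH.mercatorTerm_eq_real, BCH.bchTerm_eq_real]
  exact ⟨BCH.absolutelyConvergent_and_eq, fun _ => BCH.isLogarithm_of_mercator,
    fun _ => BCH.isLogarithm_of_bch⟩
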